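/- **Theorem 3.5 (Large deviation upper bounds for the local times).** Let $\Lambda$ be a finite or countably infinite set with at least two elements, and let $A=(A_{x,y})_{x,y\in\Lambda}$ be a symmetric real matrix that is the conservative generator ($Q$-matrix) of a continuous-time Markov chain $(X_t)_{t\ge 0}$ on $\Lambda$ with right-continuous paths; that is, $A_{x,y}\ge 0$ for $x\ne y$, $\sum_{y\in\Lambda}A_{x,y}=0$ for every $x$, and $A_{x,y}=\lim_{t\downarrow0}\frac1t\big(\mathbb P_x(X_t=y)-\delta_{x,y}\big)$, where under $\mathbb P_a$ the chain starts at $a$; $\mathbb E_a$ denotes expectation under $\mathbb P_a$. Let $\ell_T(x)=\int_0^T 1_{\{X_s=x\}}\,ds$ be the local times and $R_T=\operatorname{supp}(\ell_T)=\{x\in\Lambda:\ell_T(x)\neq0\}$ the range. For a finite set $S\subseteq\Lambda$ let $\mathcal M_1(S)$ be the set of probability measures on $S$ (probability vectors indexed by $S$), and put $$\eta_S=\max\Big\{\max_{x\in S}\sum_{y\in S\setminus\{x\}}|A_{x,y}|,\ \max_{y\in S}\sum_{x\in S\setminus\{y\}}|A_{x,y}|,\ 1\Big\}.$$ For $\mu\in\mathcal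 M_1(S)$, extended by $0$ to $\Lambda$, let $$\big\|(-A)^{1/2}\sqrt\mu\big\|_2^2=\frac12\sum_{x,y\in\Lambda}A_{x,y}\big(\sqrt{\mu(x)}-\sqrt{\mu(y)}\big)^2$$ be the Dirichlet form of $A$ at $\sqrt\mu$. Then, for every finite $S\subseteq\Lambda$, every $T\ge1$ and every $a\in S$, the following hold (with $\log 0=-\infty$, $\log\infty=\infty$, $\inf\emptyset=+\infty$; on $\{R_T\subseteq S\}$ the tuple $\frac1T\ell_T$ is regarded as an element of $\mathcal M_1(S)$). (i) For every measurable $\Gamma\subseteq\mathcal M_1(S)$, $$\log\mathbb P_a\Big(\tfrac1T\ell_T\in\Gamma,\ R_T\subseteq S\Big)\le -T\inf_{\mu\in\Gamma}\big\|(-A)^{1/2}\sqrt\mu\big\|_2^2+|S|\log\big(\eta_S\sqrt{8e}\,T\big)+\log|S|+\frac{|S|}{4T}.$$ (ii) For every measurable $F\colon\mathcal M_1(S)\to\mathbb R$, $$\log\mathbb E_a\Big[e^{TF(\frac1T\ell_T)}1_{\{R_T\subseteq S\}}\Big]\le T\sup_{\mu\in\mathcal M_1(S)}\Big[F(\mu)-\big\|(-A)^{1/2}\sqrt\mu\big\|_2^2\Big]+|S|\log\big(\eta_S\sqrt{8e}\,T\big)+\log|S|+\frac{|S|}{4T}.$$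 -/

import Mathlib

open MeasureTheory Filter Topology
open scoped NNReal ENNReal

noncomputable section

/-- `A` is a conservative `Q`-matrix on `Λ`: the off-diagonal entries are nonnegative
and every row is (absolutely) summable with sum `0`. -/
structure IsConservativeQMatrix {Λ : Type*} (A : Matrix Λ Λ ℝ) : Prop where
  offDiag_nonneg : ∀ x y, x ≠ y → 0 ≤ A x y
  row_hasSum : ∀ x, HasSum (fun y => A x y) 0

/-- `X` is a continuous-time Markov chain on the discrete space `Λ` with generator
(`Q`-matrix) `A`, the chain starting at `a` under `P a`. -/
structure IsMarkovChain {Λ Ω : Type*} [MeasurableSpace Ω] (A : Matrix Λ Λ ℝ)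
    (X : ℝ≥0 → Ω → Λ) (P : Λ → Measure Ω) : Prop where
  isProbabilityMeasure : ∀ a, IsProbabilityMeasure (P a)
  measurableSet_eq : ∀ t x, MeasurableSet {ω | X t ω = x}
  /-- The paths are right-continuous for the discrete topology on `Λ`. -/
  rightContinuous : ∀ ω t, ∀ᶠ s in 𝓝[>] t, X s ω = X t ω
  start : ∀ a, ∀ᵐ ω ∂(P a), X 0 ω = a
  /-- The time-homogeneous Markov property with respect to the natural filtration. -/
  markov : ∀ (a : Λ) (s t : ℝ≥0) (E : Set Ω),
    MeasurableSet[⨆ u : Set.Iic s, MeasurableSpace.comap (X u) ⊤] E → ∀ x y : Λ,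
      P a (E ∩ {ω | X s ω = x} ∩ {ω | X (s + t) ω = y})
        = P a (E ∩ {ω | X s ω = x}) * P x {ω | X t ω = y}
  /-- `A` is the derivative at time `0` of the transition probabilities. -/
  generator : ∀ x y : Λ,
    Tendsto (fun t : ℝ≥0 =>
        ((P x).real {ω | X t ω = y} - Set.indicator {x} (fun _ => (1 : ℝ)) y) / (t : ℝ))
      (𝓝[>] 0) (𝓝 (A x y))

/-- The local time `ℓ_T(x) = ∫_0^T 1{X_s = x} ds`. -/
def localTime {Λ Ω : Type*} (X : ℝ≥0 → Ω → Λ) (T : ℝ) (ω : Ω) (x : Λ) : ℝ :=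
  ∫ s in (0 : ℝ)..T, Set.indicator {s : ℝ | X s.toNNReal ω = x} (fun _ => (1 : ℝ)) s

/-- The range `R_T = supp ℓ_T`. -/
def rangeUpTo {Λ Ω : Type*} (X : ℝ≥0 → Ω → Λ) (T : ℝ) (ω : Ω) : Set Λ :=
  Function.support (localTime X T ω)

/-- The restriction to `S` of the normalized local times `ℓ_T / T`; on `{R_T ⊆ S}` it is
a probability vector on `S`. -/
def normalizedLocalTime {Λ Ω : Type*} (X : ℝ≥0 → Ω → Λ) (T : ℝ) (S : Finset Λ) (ω : Ω) :
    S → ℝ :=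
  fun x => localTime X T ω x / T

/-- The maximum of `1` and all row sums and column sums over `S` of the absolute values of
the off-diagonal part of `A`. -/
def etaConst {Λ : Type*} (A : Matrix Λ Λ ℝ) (S : Finset Λ) : ℝ :=
  open Classical in
  max (max (⨆ x : S, ∑ y ∈ S.erase x, |A x y|) (⨆ y : S, ∑ x ∈ S.erase y, |A x y|)) 1

/-- The function `√μ` on `Λ`, for `μ` a measure on `S ⊆ Λ` (extended by `0`). -/
def sqrtDensity {Λ : Type*} (S : Finset Λ) (μ : S → ℝ) : Λ → ℝ :=
  open Classical in
  fun x => if h : x ∈ S then √(μ ⟨x, h⟩) else 0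

/-- The Dirichlet form `½ ∑_{x,y} A_{xy} (f x - f y)²` of `A`. For symmetric `A` this is
`‖(-A)^{1/2} f‖₂²` for finitely supported `f`; see `norm_sq_eq_dirichletForm`. -/
def dirichletForm {Λ : Type*} (A : Matrix Λ Λ ℝ) (f : Λ → ℝ) : ℝ :=
  (1 / 2) * ∑' p : Λ × Λ, A p.1 p.2 * (f p.1 - f p.2) ^ 2

/-- The rate function `‖(-A)^{1/2} √μ‖₂²` at a probability vector `μ` on `S`. -/
def rate {Λ : Type*} (A : Matrix Λ Λ ℝ) (S : Finset Λ) (μ : S → ℝ) : ℝ :=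
  dirichletForm A (sqrtDensity S μ)

theorem hasSum_dirichlet {Λ : Type*} {A : Matrix Λ Λ ℝ} (hA : IsConservativeQMatrix A)
    (hs : A.IsSymm) (S : Finset Λ) (f : Λ → ℝ) (hf : ∀ x, x ∉ S → f x = 0) :
    HasSum (fun p : Λ × Λ => A p.1 p.2 * (f p.1 - f p.2) ^ 2)
      (2 * -∑ x ∈ S, ∑ y ∈ S, f x * A x y * f y) := by
  classical
  have hsy : ∀ x y, A y x = A x y := fun x y => hs.apply x y
  have row : ∀ g : Λ → ℝ, (∀ x, x ∉ S → g x = 0) →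
      HasSum (fun p : Λ × Λ => A p.1 p.2 * g p.1) 0 := by
    intro g hg
    have h1 : ∀ z ∈ S, HasSum (fun p : Λ × Λ => if p.1 = z then A z p.2 * g z else 0) 0 := by
      intro z _
      have hi : Function.Injective (fun y : Λ => (z, y)) := fun a b h => by simpa using h
      refine (Function.Injective.hasSum_iff hi ?_).1 ?_
      · rintro ⟨u, v⟩ huv
        have : u ≠ z := fun h => huv ⟨v, by simp [h]⟩
        simp [this]
      · have := (hA.row_hasSum z).mul_right (g z)
        simpa [Function.comp_def] using this
    have h2 := hasSum_sum h1
    simp only [Finset.sum_const_zero] at h2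
    refine h2.congr_fun ?_
    rintro ⟨u, v⟩
    by_cases hu : u ∈ S <;> simp [hu, hg]
  have row1 := row (fun x => f x ^ 2) (fun x hx => by simp [hf x hx])
  have row2 : HasSum (fun p : Λ × Λ => A p.1 p.2 * f p.2 ^ 2) 0 := by
    have := (Equiv.prodComm Λ Λ).hasSum_iff.2 row1
    refine this.congr_fun ?_
    rintro ⟨u, v⟩
    simp [hsy]
  have cross : HasSum (fun p : Λ × Λ => f p.1 * A p.1 p.2 * f p.2)
      (∑ x ∈ S, ∑ y ∈ S, f x * A x y * f y) := by
    rw [← Finset.sum_product' S S (fun x y => f x * A x y * f y)]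
    refine hasSum_sum_of_ne_finset_zero ?_
    rintro ⟨u, v⟩ huv
    simp only [Finset.mem_product, not_and_or] at huv
    rcases huv with h | h <;> simp [hf _ h]
  have := (row1.add row2).add (cross.mul_left (-2))
  convert this using 1
  · funext p; ring
  · ring

theorem dirichletForm_eq {Λ : Type*} {A : Matrix Λ Λ ℝ} (hA : IsConservativeQMatrix A)
    (hs : A.IsSymm) (S : Finset Λ) (f : Λ → ℝ) (hf : ∀ x, x ∉ S → f x = 0) :
    dirichletForm A f = -∑ x ∈ S, ∑ y ∈ S, f x * A x y * f y := by
  rw [dirichletForm, (hasSum_dirichlet hA hs S f hf).tsum_eq]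
  ring

/-- `H` is a nonnegative self-adjoint operator on `ℓ²(Λ)` whose square extends the action of
`-A` on finitely supported functions, i.e. `H = (-A)^{1/2}`. -/
structure IsSqrtNeg {Λ : Type*} (A : Matrix Λ Λ ℝ)
    (H : lp (fun _ : Λ => ℝ) 2 →ₗ.[ℝ] lp (fun _ : Λ => ℝ) 2) : Prop where
  isSelfAdjoint : IsSelfAdjoint H
  nonneg : ∀ u : H.domain, 0 ≤ inner ℝ (H u) (u : lp (fun _ : Λ => ℝ) 2)
  sq : ∀ (f : lp (fun _ : Λ => ℝ) 2) (S : Finset Λ), (∀ x, x ∉ S → f x = 0) →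
    ∃ (h : f ∈ H.domain) (h' : H ⟨f, h⟩ ∈ H.domain),
      ∀ x, H ⟨H ⟨f, h⟩, h'⟩ x = -∑ y ∈ S, A x y * f y

theorem norm_sq_eq_dirichletForm {Λ : Type*} {A : Matrix Λ Λ ℝ}
    (hA : IsConservativeQMatrix A) (hs : A.IsSymm)
    {H : lp (fun _ : Λ => ℝ) 2 →ₗ.[ℝ] lp (fun _ : Λ => ℝ) 2} (hH : IsSqrtNeg A H)
    (f : H.domain) (S : Finset Λ) (hf : ∀ x, x ∉ S → (f : lp (fun _ : Λ => ℝ) 2) x = 0) :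
    ‖H f‖ ^ 2 = dirichletForm A (fun x => (f : lp (fun _ : Λ => ℝ) 2) x) := by
  obtain ⟨f, hfd⟩ := f
  obtain ⟨h, h', e⟩ := hH.sq f S hf
  have hsa : H.adjoint = H := hH.isSelfAdjoint
  have hadj := LinearPMap.adjoint_isFormalAdjoint hH.isSelfAdjoint.dense_domain
  rw [hsa] at hadj
  rw [dirichletForm_eq hA hs S _ hf, ← real_inner_self_eq_norm_sq]
  have key : inner ℝ (H ⟨f, h⟩) (H ⟨f, h⟩) = inner ℝ (H ⟨H ⟨f, h⟩, h'⟩) f := by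
    exact (hadj ⟨H ⟨f, h⟩, h'⟩ ⟨f, h⟩).symm
  rw [key, lp.inner_eq_tsum, tsum_eq_sum (s := S) (fun x hx => by
    have h0 : f x = 0 := hf x hx
    simp [h0])]
  rw [← Finset.sum_neg_distrib]
  refine Finset.sum_congr rfl fun x _ => ?_
  rw [e x]
  simp only [RCLike.inner_apply, conj_trivial, mul_neg, Finset.mul_sum]
  congr 1
  exact Finset.sum_congr rfl fun y _ => by ring

end

/-! Take `f ≥ 1` on `S` and `V = -(A_S f) / f`, where `A_S` is the restriction of `A` to `S`. Then
`A_S f + V f = 0`, so that `f(X_t) exp (∫₀ᵗ V(X_s) ds)`, killed on leaving `S`, is a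
supermartingale, and `E_a [exp (∑ V(x) ℓ_T(x)); R_T ⊆ S] ≤ f(a)`. This is proved by discretising
time: the Markov property handles one step, and Fatou's lemma the limit of vanishing mesh.

With `r = √μ`, symmetry of `A` gives the ground state identity
`-⟨r, A_S r⟩ = ∑ V r² + ½ ∑ A(x,y) f(x) f(y) (r(x)/f(x) - r(y)/f(y))²`. The choice `f = r` would
kill the last term, but `f` must not depend on the path. Scaling `r` to have maximum `N` and
rounding up to integers between `1` and `N` gives an `f` from a family of at most `|S| N^(|S|-1)`
functions, and the last term is then at most `|S| η_S / (2N)`. A union bound over this family with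
`N = ⌈η_S T⌉` bounds `E_a [exp (T rate(ℓ_T / T)); R_T ⊆ S]`, from which both estimates follow by
Chebyshev's inequality. -/

section RiemannSums

/-- The least point of the grid `hℤ` that is at least `t`. Rounding up keeps the Riemann sums
on the side of `t` on which right continuity gives information. -/
noncomputable def gridCeil (h t : ℝ) : ℝ := ⌈t / h⌉ * h

theorem le_gridCeil {h : ℝ} (hh : 0 < h) (t : ℝ) : t ≤ gridCeil h t :=
  (div_le_iff₀ hh).1 (Int.le_ceil _)

theorem gridCeil_le_add {h : ℝ} (hh : 0 < h) (t : ℝ) : gridCeil h t ≤ t + h :=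
  calc gridCeil h t ≤ (t / h + 1) * h := by
        unfold gridCeil; gcongr; exact (Int.ceil_lt_add_one _).le
    _ = t + h := by field_simp

theorem gridCeil_eq_of_mem_Ioc {h t : ℝ} (hh : 0 < h) {k : ℕ}
    (ht : t ∈ Set.Ioc (k * h) ((k + 1 : ℕ) * h)) : gridCeil h t = (k + 1 : ℕ) * h := by
  have hceil : ⌈t / h⌉ = (k + 1 : ℕ) := by
    rw [Int.ceil_eq_iff, lt_div_iff₀ hh, div_le_iff₀ hh]
    simpa using ht
  rw [gridCeil, hceil, Int.cast_natCast]

theorem measurable_comp_gridCeil {β : Type*} [MeasurableSpace β] (v : ℝ → β) (h : ℝ) :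
    Measurable fun t => v (gridCeil h t) :=
  (measurable_from_top (f := fun k : ℤ => v (k * h))).comp
    (Int.measurable_ceil.comp (measurable_id.div_const h))

theorem tendsto_gridCeil {h : ℕ → ℝ} (hpos : ∀ m, 0 < h m) (hlim : Tendsto h atTop (𝓝 0)) (t : ℝ) :
    Tendsto (fun m => gridCeil (h m) t) atTop (𝓝[≥] t) := by
  refine tendsto_nhdsWithin_iff.2 ⟨?_, .of_forall fun m => le_gridCeil (hpos m) t⟩
  exact tendsto_of_tendsto_of_tendsto_of_le_of_le tendsto_const_nhds
    (by simpa using hlim.const_add t) (fun m => le_gridCeil (hpos m) t)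
    (fun m => gridCeil_le_add (hpos m) t)

theorem tendsto_const_div_succ (T : ℝ) :
    Tendsto (fun m : ℕ => T / (m + 1)) atTop (𝓝 0) := by
  simpa [div_eq_mul_inv] using (tendsto_one_div_add_atTop_nhds_zero_nat (𝕜 := ℝ)).const_mul T

theorem measurable_of_rightContinuous {v : ℝ → ℝ}
    (hv : ∀ t, ContinuousWithinAt v (Set.Ici t) t) : Measurable v :=
  measurable_of_tendsto_metrizable
    (fun m : ℕ => measurable_comp_gridCeil v (1 / (m + 1)))
    (tendsto_pi_nhds.2 fun t =>
      (hv t).tendsto.comp (tendsto_gridCeil (fun m => by positivity) (tendsto_const_div_succ 1) t))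

variable {v : ℝ → ℝ} {C : ℝ}

theorem intervalIntegrable_comp_gridCeil (hC : ∀ t, |v t| ≤ C) (h a b : ℝ) :
    IntervalIntegrable (fun t => v (gridCeil h t)) volume a b :=
  (intervalIntegrable_const (c := C)).mono_fun
    (measurable_comp_gridCeil v h).aestronglyMeasurable
    (.of_forall fun _ => (hC _).trans (le_abs_self C))

theorem intervalIntegrable_of_rightContinuous (hv : ∀ t, ContinuousWithinAt v (Set.Ici t) t)
    (hC : ∀ t, |v t| ≤ C) (a b : ℝ) : IntervalIntegrable v volume a b :=
  (intervalIntegrable_const (c := C)).mono_fun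
    (measurable_of_rightContinuous hv).aestronglyMeasurable
    (.of_forall fun _ => (hC _).trans (le_abs_self C))

theorem integral_comp_gridCeil (hC : ∀ t, |v t| ≤ C) {h : ℝ} (hh : 0 < h) (n : ℕ) :
    ∫ t in (0 : ℝ)..n * h, v (gridCeil h t) = ∑ k ∈ Finset.range n, h * v ((k + 1 : ℕ) * h) := by
  have hsum := intervalIntegral.sum_integral_adjacent_intervals (μ := volume)
    (f := fun t => v (gridCeil h t)) (a := fun k : ℕ => (k : ℝ) * h) (n := n)
    fun _ _ => intervalIntegrable_comp_gridCeil hC h _ _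
  rw [Nat.cast_zero, zero_mul] at hsum
  rw [← hsum]
  refine Finset.sum_congr rfl fun k _ => ?_
  have hle : (k : ℝ) * h ≤ (k + 1 : ℕ) * h := by gcongr; simp
  have hconst : ∀ t ∈ Set.Ioc ((k : ℝ) * h) ((k + 1 : ℕ) * h),
      v (gridCeil h t) = v ((k + 1 : ℕ) * h) :=
    fun t ht => by rw [gridCeil_eq_of_mem_Ioc hh ht]
  rw [intervalIntegral.integral_of_le hle, setIntegral_congr_fun measurableSet_Ioc hconst,
    ← intervalIntegral.integral_of_le hle, intervalIntegral.integral_const, smul_eq_mul]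
  push_cast
  ring

theorem tendsto_integral_comp_gridCeil (hv : ∀ t, ContinuousWithinAt v (Set.Ici t) t)
    (hC : ∀ t, |v t| ≤ C) {h : ℕ → ℝ} (hpos : ∀ m, 0 < h m) (hlim : Tendsto h atTop (𝓝 0))
    (a b : ℝ) :
    Tendsto (fun m => ∫ t in a..b, v (gridCeil (h m) t)) atTop (𝓝 (∫ t in a..b, v t)) :=
  intervalIntegral.tendsto_integral_filter_of_dominated_convergence (fun _ => C)
    (.of_forall fun _ => (measurable_comp_gridCeil v _).aestronglyMeasurable)
    (.of_forall fun _ => .of_forall fun _ _ => hC _) intervalIntegrable_const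
    (.of_forall fun t _ => (hv t).tendsto.comp (tendsto_gridCeil hpos hlim t))

theorem tendsto_leftRiemannSum (hv : ∀ t, ContinuousWithinAt v (Set.Ici t) t)
    (hC : ∀ t, |v t| ≤ C) {T : ℝ} (hT : 0 < T) :
    Tendsto (fun m : ℕ => ∑ k ∈ Finset.range (m + 1), T / (m + 1) * v (k * (T / (m + 1))))
      atTop (𝓝 (∫ t in (0 : ℝ)..T, v t)) := by
  have hpos : ∀ m : ℕ, 0 < T / (m + 1) := fun m => by positivity
  have hright := tendsto_integral_comp_gridCeil hv hC hpos (tendsto_const_div_succ T) 0 T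
  have hends := (tendsto_const_div_succ T).mul_const (v 0 - v T)
  refine ((hright.add hends).congr fun m => ?_).trans (by simp)
  have hT' : ((m + 1 : ℕ) : ℝ) * (T / (m + 1)) = T := by push_cast; field_simp
  have hsum := integral_comp_gridCeil hC (hpos m) (m + 1)
  have htel := Finset.sum_range_sub (fun k : ℕ => T / (m + 1) * v (k * (T / (m + 1)))) (m + 1)
  rw [hT'] at hsum htel
  rw [hsum]
  simp only [Finset.sum_sub_distrib, Nat.cast_zero, zero_mul] at htel
  linarith

end RiemannSums

section Paths

variable {Λ Ω : Type*} {X : ℝ≥0 → Ω → Λ} {ω : Ω}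

/-- The indicator of the set of times that the path `ω` spends at `x`; the local time at `x` is
its integral. -/
noncomputable def occupation (X : ℝ≥0 → Ω → Λ) (ω : Ω) (x : Λ) : ℝ → ℝ :=
  Set.indicator {s : ℝ | X s.toNNReal ω = x} fun _ => 1

theorem occupation_apply [DecidableEq Λ] (ω : Ω) (x : Λ) (t : ℝ) :
    occupation X ω x t = if X t.toNNReal ω = x then 1 else 0 := by
  simp [occupation, Set.indicator_apply]

theorem occupation_nonneg (ω : Ω) (x : Λ) (t : ℝ) : 0 ≤ occupation X ω x t :=
  Set.indicator_nonneg (fun _ _ => zero_le_one) t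

theorem abs_occupation_le (ω : Ω) (x : Λ) (t : ℝ) : |occupation X ω x t| ≤ 1 := by
  rw [abs_of_nonneg (occupation_nonneg ω x t)]
  exact Set.indicator_le_self' (fun _ _ => zero_le_one) t

theorem sum_mul_occupation {S : Finset Λ} (V : Λ → ℝ) {t : ℝ≥0} (h : X t ω ∈ S) :
    ∑ x ∈ S, V x * occupation X ω x t = V (X t ω) := by
  classical
  simp only [occupation_apply, Real.toNNReal_coe, mul_ite, mul_one, mul_zero]
  rw [Finset.sum_ite_eq, if_pos h]

theorem integral_occupation (ω : Ω) (x : Λ) (T : ℝ) :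
    ∫ t in (0 : ℝ)..T, occupation X ω x t = localTime X T ω x := rfl

theorem localTime_nonneg (ω : Ω) (x : Λ) (T : ℝ≥0) : 0 ≤ localTime X T ω x :=
  intervalIntegral.integral_nonneg T.2 fun t _ => occupation_nonneg ω x t

theorem eventually_toNNReal_eq (hω : ∀ t, ∀ᶠ s in 𝓝[>] t, X s ω = X t ω) (t : ℝ) :
    ∀ᶠ s : ℝ in 𝓝[>] t, X s.toNNReal ω = X t.toNNReal ω := by
  rcases lt_or_ge t 0 with ht | ht
  · filter_upwards [Ioo_mem_nhdsGT ht] with s hs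
    rw [Real.toNNReal_of_nonpos hs.2.le, Real.toNNReal_of_nonpos ht.le]
  · have htendsto : Tendsto Real.toNNReal (𝓝[>] t) (𝓝[>] t.toNNReal) :=
      tendsto_nhdsWithin_iff.2 ⟨(continuous_real_toNNReal.tendsto t).mono_left nhdsWithin_le_nhds,
        eventually_mem_nhdsWithin.mono fun s hs =>
          (Real.toNNReal_lt_toNNReal_iff_of_nonneg ht).2 hs⟩
    exact htendsto.eventually (hω t.toNNReal)

theorem continuousWithinAt_occupation (hω : ∀ t, ∀ᶠ s in 𝓝[>] t, X s ω = X t ω) (x : Λ) (t : ℝ) :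
    ContinuousWithinAt (occupation X ω x) (Set.Ici t) t := by
  classical
  refine continuousWithinAt_Ioi_iff_Ici.1 (tendsto_const_nhds.congr' ?_)
  filter_upwards [eventually_toNNReal_eq hω t] with s hs
  rw [occupation_apply, occupation_apply, hs]

theorem mem_of_rangeUpTo_subset (hω : ∀ t, ∀ᶠ s in 𝓝[>] t, X s ω = X t ω) {T : ℝ} {S : Set Λ}
    (hR : rangeUpTo X T ω ⊆ S) {t : ℝ≥0} (ht : t < T) : X t ω ∈ S := by
  classical
  refine hR (ne_of_gt ?_)
  obtain ⟨b, hb, hsub⟩ := (mem_nhdsGT_iff_exists_Ioo_subset' ht).1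
    ((eventually_toNNReal_eq hω t).and (Ioo_mem_nhdsGT ht))
  rw [← integral_occupation, intervalIntegral.integral_pos_iff_support_of_nonneg_ae
    (.of_forall (occupation_nonneg ω (X t ω)))
    (intervalIntegrable_of_rightContinuous (continuousWithinAt_occupation hω _)
      (abs_occupation_le ω _) _ _)]
  refine ⟨t.2.trans_lt ht, lt_of_lt_of_le ?_ (measure_mono (s := Set.Ioo (t : ℝ) b) ?_)⟩
  · rw [Real.volume_Ioo, ENNReal.ofReal_pos]
    exact sub_pos.2 hb
  · intro s hs
    obtain ⟨hXs, hsT⟩ := hsub hs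
    exact ⟨by simpa [occupation_apply] using hXs, t.2.trans_lt hs.1, hsT.2.le⟩

theorem tendsto_sum_localTime (hω : ∀ t, ∀ᶠ s in 𝓝[>] t, X s ω = X t ω) {T : ℝ≥0} (hT : 0 < T)
    (x : Λ) :
    Tendsto (fun m : ℕ => ∑ k ∈ Finset.range (m + 1),
        T / (m + 1) * occupation X ω x (k * (T / (m + 1)) : ℝ≥0))
      atTop (𝓝 (localTime X T ω x)) := by
  simpa [integral_occupation] using tendsto_leftRiemannSum (continuousWithinAt_occupation hω x)
    (abs_occupation_le ω x) (NNReal.coe_pos.2 hT)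

theorem natCast_mul_div_succ_lt {T : ℝ≥0} (hT : 0 < T) {k m : ℕ} (hk : k ∈ Finset.range (m + 1)) :
    k * (T / (m + 1)) < T := by
  have hkm : (k : ℝ≥0) < m + 1 := by exact_mod_cast Finset.mem_range.1 hk
  rw [mul_div_left_comm]
  exact mul_lt_of_lt_one_right hT ((div_lt_one (by positivity)).2 hkm)

theorem tendsto_sum_potential (hω : ∀ t, ∀ᶠ s in 𝓝[>] t, X s ω = X t ω) {T : ℝ≥0} (hT : 0 < T)
    {S : Finset Λ} (hR : rangeUpTo X T ω ⊆ S) (V : Λ → ℝ) :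
    Tendsto (fun m : ℕ => ∑ k ∈ Finset.range (m + 1),
        T / (m + 1) * V (X (k * (T / (m + 1))) ω))
      atTop (𝓝 (∑ x ∈ S, V x * localTime X T ω x)) := by
  refine (tendsto_finsetSum S fun x _ => (tendsto_sum_localTime hω hT x).const_mul (V x)).congr
    fun m => ?_
  simp only [Finset.mul_sum]
  rw [Finset.sum_comm]
  refine Finset.sum_congr rfl fun k hk => ?_
  have hmem := mem_of_rangeUpTo_subset hω hR (NNReal.coe_lt_coe.2 (natCast_mul_div_succ_lt hT hk))
  rw [← sum_mul_occupation V hmem, Finset.mul_sum]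
  exact Finset.sum_congr rfl fun x _ => mul_left_comm ..

theorem sum_localTime (hω : ∀ t, ∀ᶠ s in 𝓝[>] t, X s ω = X t ω) {T : ℝ≥0} (hT : 0 < T)
    {S : Finset Λ} (hR : rangeUpTo X T ω ⊆ S) : ∑ x ∈ S, localTime X T ω x = T := by
  have hlim := tendsto_sum_potential hω hT hR fun _ => 1
  simp only [one_mul] at hlim
  refine tendsto_nhds_unique hlim (tendsto_const_nhds.congr fun m => ?_)
  rw [Finset.sum_const, Finset.card_range, nsmul_eq_mul]
  push_cast
  field_simp

theorem normalizedLocalTime_mem_stdSimplex (hω : ∀ t, ∀ᶠ s in 𝓝[>] t, X s ω = X t ω) {T : ℝ≥0}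
    (hT : 0 < T) {S : Finset Λ} (hR : rangeUpTo X T ω ⊆ S) :
    normalizedLocalTime X T S ω ∈ stdSimplex ℝ S := by
  refine ⟨fun x => div_nonneg (localTime_nonneg ω x.1 T) T.2, ?_⟩
  simp only [normalizedLocalTime]
  rw [← Finset.sum_div, Finset.sum_coe_sort S (localTime X T ω), sum_localTime hω hT hR,
    div_self (NNReal.coe_ne_zero.2 hT.ne')]

variable [MeasurableSpace Ω] {A : Matrix Λ Λ ℝ} {P : Λ → Measure Ω}

theorem IsMarkovChain.measurable_localTime (hX : IsMarkovChain A X P) {T : ℝ≥0} (hT : 0 < T)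
    (x : Λ) : Measurable fun ω => localTime X T ω x := by
  classical
  refine measurable_of_tendsto_metrizable (fun m => ?_)
    (tendsto_pi_nhds.2 fun ω => tendsto_sum_localTime (hX.rightContinuous ω) hT x)
  simp only [occupation_apply, Real.toNNReal_coe]
  exact Finset.measurable_sum _ fun k _ =>
    (Measurable.ite (hX.measurableSet_eq _ x) measurable_const measurable_const).const_mul _

theorem IsMarkovChain.measurable_normalizedLocalTime (hX : IsMarkovChain A X P) {T : ℝ≥0}
    (hT : 0 < T) (S : Finset Λ) : Measurable (normalizedLocalTime X T S) :=
  measurable_pi_lambda _ fun x => (hX.measurable_localTime hT x).div_const _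

end Paths

section MarkovProperty

variable {Λ Ω : Type*} {S : Finset Λ} {X : ℝ≥0 → Ω → Λ}

theorem measurable_comp_of_measurableSet_fiber {_ : MeasurableSpace Ω} {Y : Ω → Λ}
    (hY : ∀ y ∈ S, MeasurableSet {ω | Y ω = y}) {g : Λ → ℝ≥0∞} (hg : ∀ y ∉ S, g y = 0) :
    Measurable fun ω => g (Y ω) := by
  classical
  have hsum : (fun ω => g (Y ω)) = fun ω => ∑ y ∈ S, if Y ω = y then g y else 0 := by
    funext ω
    rw [Finset.sum_ite_eq]
    exact (ite_eq_left_iff.2 fun h => (hg _ h).symm).symm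
  rw [hsum]
  exact Finset.measurable_sum _ fun y hy => .ite (hY y hy) measurable_const measurable_const

/-- The events that the path sees up to time `s`, generated by `{X_u = x}` with `u ≤ s`. -/
abbrev pastSigmaAlgebra (X : ℝ≥0 → Ω → Λ) (s : ℝ≥0) : MeasurableSpace Ω :=
  .generateFrom {E | ∃ u ≤ s, ∃ x, E = {ω | X u ω = x}}

theorem measurableSet_pastSigmaAlgebra {s u : ℝ≥0} (hu : u ≤ s) (x : Λ) :
    MeasurableSet[pastSigmaAlgebra X s] {ω | X u ω = x} :=
  MeasurableSpace.measurableSet_generateFrom ⟨u, hu, x, rfl⟩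

theorem pastSigmaAlgebra_le_iSup_comap (s : ℝ≥0) :
    pastSigmaAlgebra X s ≤ ⨆ u : Set.Iic s, MeasurableSpace.comap (X u) ⊤ := by
  refine MeasurableSpace.generateFrom_le ?_
  rintro _ ⟨u, hu, x, rfl⟩
  exact le_iSup (fun u : Set.Iic s => MeasurableSpace.comap (X u) ⊤) ⟨u, hu⟩ _ ⟨{x}, trivial, rfl⟩

theorem measurable_prod_comp {g : Λ → ℝ≥0∞} (hg : ∀ y ∉ S, g y = 0) (h : ℝ≥0) (m : ℕ) :
    Measurable[pastSigmaAlgebra X (m * h)]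
      fun ω => ∏ k ∈ Finset.range (m + 1), g (X (k * h) ω) := by
  refine Finset.measurable_prod _ fun k hk => ?_
  have hkm : k * h ≤ m * h := by
    gcongr
    exact Nat.lt_succ_iff.1 (Finset.mem_range.1 hk)
  exact measurable_comp_of_measurableSet_fiber
    (fun y _ => measurableSet_pastSigmaAlgebra hkm y) hg

variable [MeasurableSpace Ω] {A : Matrix Λ Λ ℝ} {P : Λ → Measure Ω}

theorem lintegral_eq_sum_fiber (μ : Measure Ω) {Y : Ω → Λ}
    (hY : ∀ y ∈ S, MeasurableSet {ω | Y ω = y}) {Z : Ω → ℝ≥0∞} (hZ : ∀ ω, Y ω ∉ S → Z ω = 0) :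
    ∫⁻ ω, Z ω ∂μ = ∑ y ∈ S, ∫⁻ ω in {ω | Y ω = y}, Z ω ∂μ := by
  rw [← lintegral_biUnion_finset (fun y _ z _ hyz => ?_) hY]
  · refine (setLIntegral_eq_of_support_subset fun ω hω => ?_).symm
    by_contra h
    exact hω (hZ ω fun hS => h (by simpa using hS))
  · exact Set.disjoint_left.2 fun ω hy hz => hyz (hy.symm.trans hz)

theorem IsMarkovChain.pastSigmaAlgebra_le (hX : IsMarkovChain A X P) (s : ℝ≥0) :
    pastSigmaAlgebra X s ≤ ‹MeasurableSpace Ω› := by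
  refine MeasurableSpace.generateFrom_le ?_
  rintro _ ⟨u, -, x, rfl⟩
  exact hX.measurableSet_eq u x

theorem IsMarkovChain.lintegral_markov (hX : IsMarkovChain A X P) (a : Λ) (s t : ℝ≥0) (x y : Λ)
    {Z : Ω → ℝ≥0∞} (hZ : Measurable[pastSigmaAlgebra X s] Z) :
    ∫⁻ ω in {ω | X (s + t) ω = y} ∩ {ω | X s ω = x}, Z ω ∂P a
      = P x {ω | X t ω = y} * ∫⁻ ω in {ω | X s ω = x}, Z ω ∂P a := by
  have hm := hX.pastSigmaAlgebra_le s
  have htrim : ((P a).restrict ({ω | X (s + t) ω = y} ∩ {ω | X s ω = x})).trim hm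
      = P x {ω | X t ω = y} • ((P a).restrict {ω | X s ω = x}).trim hm := by
    refine @Measure.ext _ (pastSigmaAlgebra X s) _ _ fun E hE => ?_
    rw [Measure.smul_apply, trim_measurableSet_eq hm hE, trim_measurableSet_eq hm hE,
      Measure.restrict_apply (hm _ hE), Measure.restrict_apply (hm _ hE), smul_eq_mul,
      Set.inter_comm {ω | X (s + t) ω = y}, ← Set.inter_assoc,
      hX.markov a s t E (pastSigmaAlgebra_le_iSup_comap s _ hE) x y, mul_comm]
  rw [← lintegral_trim hm hZ, htrim, lintegral_smul_measure, lintegral_trim hm hZ, smul_eq_mul]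

theorem IsMarkovChain.setLIntegral_mul_comp (hX : IsMarkovChain A X P) (a : Λ) (s t : ℝ≥0) (x : Λ)
    {Z : Ω → ℝ≥0∞} (hZ : Measurable[pastSigmaAlgebra X s] Z) {φ : Λ → ℝ≥0∞}
    (hφ : ∀ y ∉ S, φ y = 0) :
    ∫⁻ ω in {ω | X s ω = x}, Z ω * φ (X (s + t) ω) ∂P a
      = (∑ y ∈ S, P x {ω | X t ω = y} * φ y) * ∫⁻ ω in {ω | X s ω = x}, Z ω ∂P a := by
  rw [lintegral_eq_sum_fiber _ (fun y _ => hX.measurableSet_eq (s + t) y)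
    fun ω hω => by rw [hφ _ hω, mul_zero], Finset.sum_mul]
  refine Finset.sum_congr rfl fun y _ => ?_
  have hy := hX.measurableSet_eq (s + t) y
  calc _ = ∫⁻ ω in {ω | X (s + t) ω = y} ∩ {ω | X s ω = x}, Z ω * φ y ∂P a := by
        rw [← Measure.restrict_restrict hy]
        exact setLIntegral_congr_fun hy fun ω hω => by rw [hω]
    _ = _ := by
        rw [lintegral_mul_const _ (hZ.mono (hX.pastSigmaAlgebra_le s) le_rfl),
          hX.lintegral_markov a s t x y hZ, mul_right_comm]

theorem IsMarkovChain.lintegral_mul_comp_le (hX : IsMarkovChain A X P) (a : Λ) {s t : ℝ≥0}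
    {Z : Ω → ℝ≥0∞} (hZ : Measurable[pastSigmaAlgebra X s] Z) (hZS : ∀ ω, X s ω ∉ S → Z ω = 0)
    {φ f : Λ → ℝ≥0∞} (hφ : ∀ y ∉ S, φ y = 0)
    (hle : ∀ x ∈ S, ∑ y ∈ S, P x {ω | X t ω = y} * φ y ≤ f x) :
    ∫⁻ ω, Z ω * φ (X (s + t) ω) ∂P a ≤ ∫⁻ ω, Z ω * f (X s ω) ∂P a := by
  have hfiber : ∀ x ∈ S, MeasurableSet {ω | X s ω = x} := fun x _ => hX.measurableSet_eq s x
  rw [lintegral_eq_sum_fiber _ hfiber fun ω hω => by rw [hZS ω hω, zero_mul],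
    lintegral_eq_sum_fiber _ hfiber fun ω hω => by rw [hZS ω hω, zero_mul]]
  refine Finset.sum_le_sum fun x hx => ?_
  calc _ = (∑ y ∈ S, P x {ω | X t ω = y} * φ y) * ∫⁻ ω in {ω | X s ω = x}, Z ω ∂P a :=
        hX.setLIntegral_mul_comp a s t x hZ hφ
    _ ≤ f x * ∫⁻ ω in {ω | X s ω = x}, Z ω ∂P a := by gcongr; exact hle x hx
    _ = ∫⁻ ω in {ω | X s ω = x}, Z ω * f (X s ω) ∂P a := by
        rw [mul_comm, ← lintegral_mul_const _ (hZ.mono (hX.pastSigmaAlgebra_le s) le_rfl)]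
        exact setLIntegral_congr_fun (hfiber x hx) fun ω hω => by rw [hω]

theorem IsMarkovChain.lintegral_prod_mul_le (hX : IsMarkovChain A X P) (a : Λ)
    {g f : Λ → ℝ≥0∞} (hg : ∀ y ∉ S, g y = 0) {h : ℝ≥0}
    (hstep : ∀ x ∈ S, ∑ y ∈ S, P x {ω | X h ω = y} * (g y * f y) ≤ f x) (m : ℕ) :
    ∫⁻ ω, (∏ k ∈ Finset.range (m + 1), g (X (k * h) ω)) * f (X (m * h) ω) ∂P a ≤ g a * f a := by
  induction m with
  | zero =>
    have := hX.isProbabilityMeasure a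
    have hstart : ∀ᵐ ω ∂P a, (∏ k ∈ Finset.range (0 + 1), g (X (k * h) ω)) * f (X ((0 : ℕ) * h) ω)
        = g a * f a := by
      filter_upwards [hX.start a] with ω hω
      simp [hω]
    rw [lintegral_congr_ae hstart, lintegral_const, measure_univ, mul_one]
  | succ m ih =>
    have hzero : ∀ ω, X (m * h) ω ∉ S → ∏ k ∈ Finset.range (m + 1), g (X (k * h) ω) = 0 :=
      fun ω hω => Finset.prod_eq_zero (Finset.self_mem_range_succ m) (hg _ hω)
    calc _ = ∫⁻ ω, (∏ k ∈ Finset.range (m + 1), g (X (k * h) ω))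
            * (g (X (m * h + h) ω) * f (X (m * h + h) ω)) ∂P a := by
          simp only [Finset.prod_range_succ _ (m + 1), mul_assoc, Nat.cast_succ, add_mul, one_mul]
      _ ≤ _ := hX.lintegral_mul_comp_le a (measurable_prod_comp hg h m) hzero
          (φ := fun y => g y * f y) (fun y hy => by rw [hg y hy, zero_mul]) hstep
      _ ≤ _ := ih

end MarkovProperty

section FeynmanKac

variable {Λ Ω : Type*} {S : Finset Λ} {X : ℝ≥0 → Ω → Λ}

theorem tendsto_coe_nhdsGT_zero : Tendsto ((↑) : ℝ≥0 → ℝ) (𝓝[>] 0) (𝓝[>] 0) :=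
  tendsto_nhdsWithin_iff.2 ⟨(NNReal.continuous_coe.tendsto 0).mono_left nhdsWithin_le_nhds,
    eventually_mem_nhdsWithin.mono fun _ h => NNReal.coe_pos.2 h⟩

theorem tendsto_div_succ_nhdsGT_zero {T : ℝ≥0} (hT : 0 < T) :
    Tendsto (fun m : ℕ => T / (m + 1)) atTop (𝓝[>] 0) :=
  tendsto_nhdsWithin_iff.2 ⟨NNReal.tendsto_coe.1 (by simpa using tendsto_const_div_succ T),
    .of_forall fun m => Set.mem_Ioi.2 (by positivity)⟩

theorem tendsto_exp_mul_const_nhdsGT_zero (c : ℝ) :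
    Tendsto (fun h : ℝ≥0 => Real.exp (h * c)) (𝓝[>] 0) (𝓝 1) := by
  have hcont : Continuous fun h : ℝ≥0 => Real.exp (h * c) := by fun_prop
  simpa using (hcont.tendsto 0).mono_left (nhdsWithin_le_nhds (s := Set.Ioi 0))

theorem tendsto_exp_mul_const_slope (c : ℝ) :
    Tendsto (fun h : ℝ≥0 => (Real.exp (h * c) - 1) / h) (𝓝[>] 0) (𝓝 c) := by
  have hderiv : HasDerivAt (fun t : ℝ => Real.exp (t * c)) c 0 := by
    simpa using ((hasDerivAt_id (0 : ℝ)).mul_const c).exp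
  refine (hderiv.tendsto_slope_zero_right.comp tendsto_coe_nhdsGT_zero).congr fun h => ?_
  simp [div_eq_inv_mul]

/-- One factor of the discretised Feynman-Kac weight: `exp (h V)` on `S`, and `0` outside `S`, so
that a product along a path vanishes once the path has been seen outside `S`. -/
noncomputable def killedExp (S : Finset Λ) (V : Λ → ℝ) (h : ℝ≥0) : Λ → ℝ≥0∞ :=
  (S : Set Λ).indicator fun y => ENNReal.ofReal (Real.exp (h * V y))

theorem killedExp_of_mem (V : Λ → ℝ) (h : ℝ≥0) {y : Λ} (hy : y ∈ S) :
    killedExp S V h y = ENNReal.ofReal (Real.exp (h * V y)) :=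
  Set.indicator_of_mem hy _

theorem killedExp_of_notMem (V : Λ → ℝ) (h : ℝ≥0) {y : Λ} (hy : y ∉ S) :
    killedExp S V h y = 0 :=
  Set.indicator_of_notMem hy _

theorem killedExp_le (V : Λ → ℝ) (h : ℝ≥0) (y : Λ) :
    killedExp S V h y ≤ ENNReal.ofReal (Real.exp (h * V y)) :=
  Set.indicator_le_self _ _ y

theorem tendsto_prod_killedExp {ω : Ω} (hω : ∀ t, ∀ᶠ s in 𝓝[>] t, X s ω = X t ω) {T : ℝ≥0}
    (hT : 0 < T) (hR : rangeUpTo X T ω ⊆ S) (V : Λ → ℝ) :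
    Tendsto (fun m : ℕ => ∏ k ∈ Finset.range (m + 1),
        killedExp S V (T / (m + 1)) (X (k * (T / (m + 1))) ω))
      atTop (𝓝 (ENNReal.ofReal (Real.exp (∑ x ∈ S, V x * localTime X T ω x)))) := by
  refine ((ENNReal.continuous_ofReal.comp Real.continuous_exp).tendsto _).comp
    (tendsto_sum_potential hω hT hR V) |>.congr fun m => ?_
  rw [Function.comp_apply, Function.comp_apply, Real.exp_sum,
    ENNReal.ofReal_prod_of_nonneg fun _ _ => (Real.exp_pos _).le]
  refine Finset.prod_congr rfl fun k hk => ?_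
  have hmem := mem_of_rangeUpTo_subset hω hR (NNReal.coe_lt_coe.2 (natCast_mul_div_succ_lt hT hk))
  rw [killedExp_of_mem _ _ hmem]
  push_cast
  rfl

variable [MeasurableSpace Ω] {A : Matrix Λ Λ ℝ} {P : Λ → Measure Ω}

theorem IsMarkovChain.tendsto_slope_sum_exp (hX : IsMarkovChain A X P) (V f : Λ → ℝ) {x : Λ}
    (hx : x ∈ S) :
    Tendsto (fun h : ℝ≥0 =>
        (∑ y ∈ S, (P x).real {ω | X h ω = y} * (Real.exp (h * V y) * f y) - f x) / h)
      (𝓝[>] 0) (𝓝 (∑ y ∈ S, A x y * f y + V x * f x)) := by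
  classical
  have hterm : ∀ y ∈ S, Tendsto (fun h : ℝ≥0 =>
      ((P x).real {ω | X h ω = y} - Set.indicator {x} (fun _ => (1 : ℝ)) y) / h
          * (Real.exp (h * V y) * f y)
        + if y = x then (Real.exp (h * V x) - 1) / h * f x else 0)
      (𝓝[>] 0) (𝓝 (A x y * (1 * f y) + if y = x then V x * f x else 0)) := by
    intro y _
    refine ((hX.generator x y).mul
      ((tendsto_exp_mul_const_nhdsGT_zero (V y)).mul_const (f y))).add ?_
    split_ifs
    · exact (tendsto_exp_mul_const_slope (V x)).mul_const (f x)
    · exact tendsto_const_nhds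
  refine ((tendsto_finsetSum S hterm).congr fun h => ?_).trans (le_of_eq ?_)
  · have hf : f x = ∑ y ∈ S, Set.indicator {x} (fun _ => (1 : ℝ)) y * f y := by
      simp [Set.indicator_apply, hx]
    conv_rhs => rw [hf, ← Finset.sum_sub_distrib, Finset.sum_div]
    refine Finset.sum_congr rfl fun y _ => ?_
    by_cases hy : y = x
    · subst hy; simp; ring
    · simp [hy]; ring
  · simp [Finset.sum_add_distrib, hx]

theorem IsMarkovChain.eventually_sum_exp_le (hX : IsMarkovChain A X P) {V f : Λ → ℝ}
    (hf : ∀ x ∈ S, 0 ≤ f x) (hV : ∀ x ∈ S, ∑ y ∈ S, A x y * f y + V x * f x < 0) :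
    ∀ᶠ h : ℝ≥0 in 𝓝[>] 0, ∀ x ∈ S, ∑ y ∈ S, P x {ω | X h ω = y}
      * (ENNReal.ofReal (Real.exp (h * V y)) * ENNReal.ofReal (f y)) ≤ ENNReal.ofReal (f x) := by
  refine (Finset.eventually_all S).2 fun x hx => ?_
  have := hX.isProbabilityMeasure x
  filter_upwards [(hX.tendsto_slope_sum_exp V f hx).eventually_lt_const (hV x hx)] with h hslope
  have hreal : ∑ y ∈ S, (P x).real {ω | X h ω = y} * (Real.exp (h * V y) * f y) ≤ f x :=
    (sub_neg.1 (neg_of_div_neg_left hslope h.2)).le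
  refine le_of_eq_of_le ?_ (ENNReal.ofReal_le_ofReal hreal)
  rw [ENNReal.ofReal_sum_of_nonneg fun y hy =>
    mul_nonneg measureReal_nonneg (mul_nonneg (Real.exp_pos _).le (hf y hy))]
  refine Finset.sum_congr rfl fun y _ => ?_
  rw [ENNReal.ofReal_mul measureReal_nonneg, ENNReal.ofReal_mul (Real.exp_pos _).le,
    ofReal_measureReal]

theorem IsMarkovChain.measurable_prod_killedExp (hX : IsMarkovChain A X P) (V : Λ → ℝ) (h : ℝ≥0)
    (m : ℕ) : Measurable fun ω => ∏ k ∈ Finset.range (m + 1), killedExp S V h (X (k * h) ω) :=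
  (measurable_prod_comp (fun _ => killedExp_of_notMem V h) h m).mono
    (hX.pastSigmaAlgebra_le _) le_rfl

theorem IsMarkovChain.lintegral_prod_killedExp_le (hX : IsMarkovChain A X P) (a : Λ) {V f : Λ → ℝ}
    (hf : ∀ x ∈ S, 1 ≤ f x) {h : ℝ≥0}
    (hstep : ∀ x ∈ S, ∑ y ∈ S, P x {ω | X h ω = y}
      * (ENNReal.ofReal (Real.exp (h * V y)) * ENNReal.ofReal (f y)) ≤ ENNReal.ofReal (f x))
    (m : ℕ) :
    ∫⁻ ω, ∏ k ∈ Finset.range (m + 1), killedExp S V h (X (k * h) ω) ∂P a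
      ≤ ENNReal.ofReal (Real.exp (h * V a)) * ENNReal.ofReal (f a) := by
  have hstep' : ∀ x ∈ S, ∑ y ∈ S, P x {ω | X h ω = y}
      * (killedExp S V h y * ENNReal.ofReal (f y)) ≤ ENNReal.ofReal (f x) := fun x hx => by
    rw [Finset.sum_congr rfl fun y hy => by rw [killedExp_of_mem V h hy]]
    exact hstep x hx
  calc _ ≤ ∫⁻ ω, (∏ k ∈ Finset.range (m + 1), killedExp S V h (X (k * h) ω))
          * ENNReal.ofReal (f (X (m * h) ω)) ∂P a := by
        refine lintegral_mono fun ω => ?_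
        by_cases hω : X (m * h) ω ∈ S
        · exact le_mul_of_one_le_right' (ENNReal.one_le_ofReal.2 (hf _ hω))
        · have hzero := killedExp_of_notMem V h hω
          exact (Finset.prod_eq_zero (Finset.self_mem_range_succ m) hzero).trans_le zero_le
    _ ≤ killedExp S V h a * ENNReal.ofReal (f a) :=
        hX.lintegral_prod_mul_le a (fun _ => killedExp_of_notMem V h) hstep' m
    _ ≤ _ := by gcongr; exact killedExp_le V h a

theorem IsMarkovChain.setLIntegral_exp_sum_mul_localTime_le_of_lt (hX : IsMarkovChain A X P)
    {T : ℝ≥0} (hT : 0 < T) (a : Λ) {V f : Λ → ℝ} (hf : ∀ x ∈ S, 1 ≤ f x)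
    (hV : ∀ x ∈ S, ∑ y ∈ S, A x y * f y + V x * f x < 0) :
    ∫⁻ ω in {ω | rangeUpTo X T ω ⊆ S},
        ENNReal.ofReal (Real.exp (∑ x ∈ S, V x * localTime X T ω x)) ∂P a
      ≤ ENNReal.ofReal (f a) := by
  let Z (m : ℕ) (ω : Ω) : ℝ≥0∞ :=
    ∏ k ∈ Finset.range (m + 1), killedExp S V (T / (m + 1)) (X (k * (T / (m + 1))) ω)
  have hZ : ∀ m, Measurable (Z m) := fun m => hX.measurable_prod_killedExp V _ m
  have hbound : ∀ᶠ m : ℕ in atTop, ∫⁻ ω, Z m ω ∂P a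
      ≤ ENNReal.ofReal (Real.exp ((T / (m + 1) : ℝ≥0) * V a)) * ENNReal.ofReal (f a) := by
    have hstep := hX.eventually_sum_exp_le (fun x hx => zero_le_one.trans (hf x hx)) hV
    filter_upwards [(tendsto_div_succ_nhdsGT_zero hT).eventually hstep] with m hm
    exact hX.lintegral_prod_killedExp_le a hf hm m
  have hlim : Tendsto (fun m : ℕ =>
      ENNReal.ofReal (Real.exp ((T / (m + 1) : ℝ≥0) * V a)) * ENNReal.ofReal (f a))
      atTop (𝓝 (ENNReal.ofReal (f a))) := by
    simpa using ENNReal.Tendsto.mul_const (ENNReal.tendsto_ofReal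
      ((tendsto_exp_mul_const_nhdsGT_zero (V a)).comp (tendsto_div_succ_nhdsGT_zero hT)))
      (.inr ENNReal.ofReal_ne_top)
  calc _ ≤ ∫⁻ ω in {ω | rangeUpTo X T ω ⊆ S}, liminf (fun m => Z m ω) atTop ∂P a :=
        setLIntegral_mono (.liminf hZ) fun ω hR =>
          (tendsto_prod_killedExp (hX.rightContinuous ω) hT hR V).liminf_eq.ge
    _ ≤ ∫⁻ ω, liminf (fun m => Z m ω) atTop ∂P a := setLIntegral_le_lintegral _ _
    _ ≤ liminf (fun m => ∫⁻ ω, Z m ω ∂P a) atTop := lintegral_liminf_le hZ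
    _ ≤ _ := (liminf_le_liminf hbound).trans hlim.liminf_eq.le

theorem IsMarkovChain.measurable_exp_sum_mul_localTime (hX : IsMarkovChain A X P) {T : ℝ≥0}
    (hT : 0 < T) (V : Λ → ℝ) : Measurable fun ω =>
      ENNReal.ofReal (Real.exp (∑ x ∈ S, V x * localTime X T ω x)) :=
  (Real.measurable_exp.comp (Finset.measurable_sum S fun x _ =>
    (hX.measurable_localTime hT x).const_mul (V x))).ennreal_ofReal

theorem IsMarkovChain.setLIntegral_exp_sum_mul_localTime_le (hX : IsMarkovChain A X P)
    {T : ℝ≥0} (hT : 0 < T) (a : Λ) {V f : Λ → ℝ} (hf : ∀ x ∈ S, 1 ≤ f x)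
    (hV : ∀ x ∈ S, ∑ y ∈ S, A x y * f y + V x * f x ≤ 0) :
    ∫⁻ ω in {ω | rangeUpTo X T ω ⊆ S},
        ENNReal.ofReal (Real.exp (∑ x ∈ S, V x * localTime X T ω x)) ∂P a
      ≤ ENNReal.ofReal (f a) := by
  have hshift : ∀ κ > 0, ∫⁻ ω in {ω | rangeUpTo X T ω ⊆ S},
        ENNReal.ofReal (Real.exp (∑ x ∈ S, V x * localTime X T ω x)) ∂P a
      ≤ ENNReal.ofReal (Real.exp (κ * T)) * ENNReal.ofReal (f a) := by
    intro κ hκ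
    have hVκ : ∀ x ∈ S, ∑ y ∈ S, A x y * f y + (V x - κ) * f x < 0 := fun x hx => by
      nlinarith [hV x hx, hf x hx]
    have hmeas := hX.measurable_exp_sum_mul_localTime (S := S) hT fun x => V x - κ
    refine le_trans ?_ (mul_le_mul_right
      (hX.setLIntegral_exp_sum_mul_localTime_le_of_lt hT a hf hVκ) _)
    rw [← lintegral_const_mul _ hmeas]
    refine setLIntegral_mono (hmeas.const_mul _) fun ω hR => le_of_eq ?_
    rw [← ENNReal.ofReal_mul (Real.exp_pos _).le, ← Real.exp_add]
    simp only [sub_mul, Finset.sum_sub_distrib, ← Finset.mul_sum]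
    rw [sum_localTime (hX.rightContinuous ω) hT hR, add_sub_cancel]
  have hlim : Tendsto (fun κ : ℝ => ENNReal.ofReal (Real.exp (κ * T)) * ENNReal.ofReal (f a))
      (𝓝[>] 0) (𝓝 (ENNReal.ofReal (f a))) := by
    have hcont : Continuous fun κ : ℝ => ENNReal.ofReal (Real.exp (κ * T)) :=
      ENNReal.continuous_ofReal.comp (by fun_prop)
    simpa using ENNReal.Tendsto.mul_const ((hcont.tendsto 0).mono_left nhdsWithin_le_nhds)
      (.inr ENNReal.ofReal_ne_top)
  exact ge_of_tendsto hlim (eventually_mem_nhdsWithin.mono hshift)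

end FeynmanKac

section GroundState

variable {Λ : Type*} {A : Matrix Λ Λ ℝ} {S : Finset Λ}

/-- The potential `-(A_S f) / f` on `S`, where `A_S` is `A` restricted to `S`: it turns `f` into a
ground state, `A_S f + V f = 0`. It is only meaningful where `f` does not vanish. -/
noncomputable def potential (A : Matrix Λ Λ ℝ) (S : Finset Λ) (f : Λ → ℝ) (x : Λ) : ℝ :=
  -(∑ y ∈ S, A x y * f y) / f x

theorem sum_mul_add_potential_mul (f : Λ → ℝ) {x : Λ} (hx : f x ≠ 0) :
    ∑ y ∈ S, A x y * f y + potential A S f x * f x = 0 := by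
  rw [potential, div_mul_cancel₀ _ hx, add_neg_cancel]

theorem neg_sum_sum_mul_eq_sum_potential_add (hs : A.IsSymm) {g : Λ → ℝ} (hg : ∀ x ∈ S, g x ≠ 0)
    (r : Λ → ℝ) :
    -∑ x ∈ S, ∑ y ∈ S, r x * A x y * r y = ∑ x ∈ S, potential A S g x * r x ^ 2
      + 1 / 2 * ∑ x ∈ S, ∑ y ∈ S, A x y * (g x * g y * (r x / g x - r y / g y) ^ 2) := by
  have hpot : ∑ x ∈ S, ∑ y ∈ S, A x y * (g y / g x * r x ^ 2)
      = -∑ x ∈ S, potential A S g x * r x ^ 2 := by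
    rw [← Finset.sum_neg_distrib]
    refine Finset.sum_congr rfl fun x _ => ?_
    rw [potential, neg_div, neg_mul, neg_neg, Finset.sum_div, Finset.sum_mul]
    exact Finset.sum_congr rfl fun y _ => by ring
  have hpot' : ∑ x ∈ S, ∑ y ∈ S, A x y * (g x / g y * r y ^ 2)
      = -∑ x ∈ S, potential A S g x * r x ^ 2 := by
    rw [← hpot, Finset.sum_comm]
    simp only [hs.apply]
  have hexpand : ∀ x ∈ S, ∀ y ∈ S, A x y * (g x * g y * (r x / g x - r y / g y) ^ 2)
      = A x y * (g y / g x * r x ^ 2) + A x y * (g x / g y * r y ^ 2)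
        - 2 * (r x * A x y * r y) := fun x hx y hy => by
    have := hg x hx
    have := hg y hy
    field_simp
    ring
  rw [Finset.sum_congr rfl fun x hx => Finset.sum_congr rfl (hexpand x hx)]
  simp only [Finset.sum_sub_distrib, Finset.sum_add_distrib, ← Finset.mul_sum, hpot, hpot']
  ring

theorem mul_mul_sq_div_sub_div_le {r r' g g' M : ℝ} (hr : 0 ≤ r) (hrg : r ≤ g) (hgr : g ≤ r + 1)
    (hg : 0 < g) (hgM : g ≤ M) (hr' : 0 ≤ r') (hrg' : r' ≤ g') (hgr' : g' ≤ r' + 1)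
    (hg' : 0 < g') (hgM' : g' ≤ M) : g * g' * (r / g - r' / g') ^ 2 ≤ M := by
  wlog hle : r' / g' ≤ r / g generalizing r r' g g'
  · have hswap := this hr' hrg' hgr' hg' hgM' hr hrg hgr hg hgM (le_of_not_ge hle)
    rwa [mul_comm g', sub_sq_comm] at hswap
  have hu : r / g ≤ 1 := (div_le_one hg).2 hrg
  have hu' : 0 ≤ r' / g' := div_nonneg hr' hg'.le
  have hsq : (r / g - r' / g') ^ 2 ≤ 1 - r' / g' := by nlinarith
  calc g * g' * (r / g - r' / g') ^ 2 ≤ g * g' * (1 - r' / g') := by gcongr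
    _ = g * (g' - r') := by field_simp
    _ ≤ M := by nlinarith

theorem sum_erase_le_etaConst [DecidableEq Λ] (A : Matrix Λ Λ ℝ) {x : Λ} (hx : x ∈ S) :
    ∑ y ∈ S.erase x, |A x y| ≤ etaConst A S := by
  refine le_trans ?_ ((le_max_left _ _).trans (le_max_left _ _))
  refine le_trans (le_of_eq ?_) (le_ciSup (Set.finite_range _).bddAbove (⟨x, hx⟩ : S))
  congr!

theorem one_le_etaConst (A : Matrix Λ Λ ℝ) (S : Finset Λ) : 1 ≤ etaConst A S :=
  le_max_right _ _

theorem sum_mul_le_etaConst_mul {x : Λ} (hx : x ∈ S) {D : Λ → ℝ} {M : ℝ} (hdiag : D x = 0)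
    (hD : ∀ y ∈ S, |D y| ≤ M) : ∑ y ∈ S, A x y * D y ≤ etaConst A S * M := by
  classical
  rw [← Finset.add_sum_erase S _ hx, hdiag, mul_zero, zero_add]
  calc ∑ y ∈ S.erase x, A x y * D y ≤ ∑ y ∈ S.erase x, |A x y| * M := by
        refine Finset.sum_le_sum fun y hy => (le_abs_self _).trans ?_
        rw [abs_mul]
        gcongr
        exact hD y (Finset.mem_of_mem_erase hy)
    _ ≤ etaConst A S * M := by
        rw [← Finset.sum_mul]
        gcongr
        · exact (abs_nonneg _).trans (hD x hx)
        · exact sum_erase_le_etaConst A hx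

theorem neg_sum_sum_mul_le_of_le_add_one (hs : A.IsSymm) {r g : Λ → ℝ} {M : ℝ}
    (hr : ∀ x ∈ S, 0 ≤ r x) (hrg : ∀ x ∈ S, r x ≤ g x) (hgr : ∀ x ∈ S, g x ≤ r x + 1)
    (hg : ∀ x ∈ S, 0 < g x) (hgM : ∀ x ∈ S, g x ≤ M) :
    -∑ x ∈ S, ∑ y ∈ S, r x * A x y * r y ≤ ∑ x ∈ S, potential A S g x * r x ^ 2
      + S.card * etaConst A S * M / 2 := by
  have hrow : ∀ x ∈ S, ∑ y ∈ S, A x y * (g x * g y * (r x / g x - r y / g y) ^ 2)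
      ≤ etaConst A S * M := fun x hx => by
    refine sum_mul_le_etaConst_mul hx (by rw [sub_self]; ring) fun y hy => ?_
    rw [abs_of_nonneg (mul_nonneg (mul_nonneg (hg x hx).le (hg y hy).le) (sq_nonneg _))]
    exact mul_mul_sq_div_sub_div_le (hr x hx) (hrg x hx) (hgr x hx) (hg x hx) (hgM x hx)
      (hr y hy) (hrg y hy) (hgr y hy) (hg y hy) (hgM y hy)
  have hsum := Finset.sum_le_card_nsmul S _ _ hrow
  rw [nsmul_eq_mul] at hsum
  rw [neg_sum_sum_mul_eq_sum_potential_add hs (fun x hx => (hg x hx).ne') r]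
  linarith

theorem neg_sum_sum_mul_le_of_mul_le_add_one (hs : A.IsSymm) {r g : Λ → ℝ} {c M : ℝ} (hc : c ≠ 0)
    (hr : ∀ x ∈ S, 0 ≤ c * r x) (hrg : ∀ x ∈ S, c * r x ≤ g x)
    (hgr : ∀ x ∈ S, g x ≤ c * r x + 1) (hg : ∀ x ∈ S, 0 < g x) (hgM : ∀ x ∈ S, g x ≤ M) :
    -∑ x ∈ S, ∑ y ∈ S, r x * A x y * r y ≤ ∑ x ∈ S, potential A S g x * r x ^ 2
      + S.card * etaConst A S * M / (2 * c ^ 2) := by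
  have hscaled := neg_sum_sum_mul_le_of_le_add_one hs hr hrg hgr hg hgM
  have hquad : ∑ x ∈ S, ∑ y ∈ S, c * r x * A x y * (c * r y)
      = c ^ 2 * ∑ x ∈ S, ∑ y ∈ S, r x * A x y * r y := by
    simp only [Finset.mul_sum]
    exact Finset.sum_congr rfl fun x _ => Finset.sum_congr rfl fun y _ => by ring
  have hpot : ∑ x ∈ S, potential A S g x * (c * r x) ^ 2
      = c ^ 2 * ∑ x ∈ S, potential A S g x * r x ^ 2 := by
    rw [Finset.mul_sum]
    exact Finset.sum_congr rfl fun x _ => by ring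
  have herr : S.card * etaConst A S * M / 2
      = c ^ 2 * (S.card * etaConst A S * M / (2 * c ^ 2)) := by
    field_simp
  rw [hquad, hpot, herr, ← mul_neg, ← mul_add] at hscaled
  exact le_of_mul_le_mul_left hscaled (by positivity)

end GroundState

section Grid

variable {Λ : Type*} {S : Finset Λ} {N : ℕ}

open Classical in
/-- The integer-valued functions on `S` (extended by `0`) with values in `1, …, N` that attain the
value `N`. Up to scaling they form a net of the positive functions on `S`. -/
noncomputable def gridFunctions (S : Finset Λ) (N : ℕ) : Finset (Λ →₀ ℕ) :=
  S.biUnion fun z => S.finsupp fun x => if x = z then {N} else Finset.Icc 1 N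

theorem mem_gridFunctions {k : Λ →₀ ℕ} :
    k ∈ gridFunctions S N ↔ ∃ z ∈ S, k.support ⊆ S ∧ k z = N ∧
      ∀ x ∈ S, x ≠ z → k x ∈ Finset.Icc 1 N := by
  classical
  simp only [gridFunctions, Finset.mem_biUnion, Finset.mem_finsupp_iff]
  refine exists_congr fun z => and_congr_right fun hz => and_congr_right fun _ => ?_
  refine ⟨fun h => ⟨by simpa using h z hz, fun x hx hxz => by simpa [hxz] using h x hx⟩, ?_⟩
  rintro ⟨hkz, hk⟩ x hx
  split_ifs with hxz
  · rw [hxz, hkz, Finset.mem_singleton]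
  · exact hk x hx hxz

theorem mem_Icc_of_mem_gridFunctions (hN : 1 ≤ N) {k : Λ →₀ ℕ} (hk : k ∈ gridFunctions S N)
    {x : Λ} (hx : x ∈ S) : k x ∈ Finset.Icc 1 N := by
  obtain ⟨z, -, -, hkz, hk⟩ := mem_gridFunctions.1 hk
  by_cases hxz : x = z
  · rw [hxz, hkz]; exact Finset.right_mem_Icc.2 hN
  · exact hk x hx hxz

theorem card_gridFunctions_mul_le (S : Finset Λ) (N : ℕ) :
    (gridFunctions S N).card * N ≤ S.card * N ^ S.card := by
  classical
  have hcard : ∀ z ∈ S,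
      (S.finsupp fun x => if x = z then {N} else Finset.Icc 1 N).card ≤ N ^ (S.card - 1) := by
    intro z hz
    rw [Finset.card_finsupp, ← Finset.mul_prod_erase S _ hz, if_pos rfl, Finset.card_singleton,
      one_mul, Finset.prod_congr rfl fun x hx => by rw [if_neg (Finset.ne_of_mem_erase hx)],
      Finset.prod_const, Nat.card_Icc, Nat.add_sub_cancel, Finset.card_erase_of_mem hz]
  rcases S.eq_empty_or_nonempty with rfl | hS
  · simp [gridFunctions]
  calc _ ≤ S.card * N ^ (S.card - 1) * N :=
        Nat.mul_le_mul_right N (Finset.card_biUnion_le_card_mul _ _ _ hcard)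
    _ = S.card * N ^ S.card := by rw [mul_assoc, pow_sub_one_mul hS.card_ne_zero]

theorem exists_mem_gridFunctions_le_add_one {σ : Λ → ℝ} (hσ : ∀ x ∈ S, 0 ≤ σ x)
    (hσN : ∀ x ∈ S, σ x ≤ N) {z : Λ} (hz : z ∈ S) (hσz : σ z = N) (hN : 1 ≤ N) :
    ∃ k ∈ gridFunctions S N, ∀ x ∈ S, σ x ≤ k x ∧ k x ≤ σ x + 1 := by
  let k : Λ →₀ ℕ := Finsupp.indicator S fun x _ => max 1 ⌈σ x⌉₊
  have hk : ∀ x ∈ S, k x = max 1 ⌈σ x⌉₊ := fun x hx => Finsupp.indicator_of_mem hx _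
  refine ⟨k, mem_gridFunctions.2 ⟨z, hz, Finsupp.support_indicator_subset _ _, ?_, ?_⟩, ?_⟩
  · rw [hk z hz, hσz, Nat.ceil_natCast, max_eq_right hN]
  · intro x hx _
    rw [hk x hx, Finset.mem_Icc]
    exact ⟨le_max_left _ _, max_le hN (Nat.ceil_le.2 (hσN x hx))⟩
  · intro x hx
    rw [hk x hx, Nat.cast_max, Nat.cast_one]
    exact ⟨(Nat.le_ceil _).trans (le_max_right _ _),
      max_le (by linarith [hσ x hx]) (Nat.ceil_lt_add_one (hσ x hx)).le⟩

end Grid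

section Rate

variable {Λ : Type*} {A : Matrix Λ Λ ℝ} {S : Finset Λ} {μ : S → ℝ}

theorem sqrtDensity_of_mem (μ : S → ℝ) {x : Λ} (hx : x ∈ S) : sqrtDensity S μ x = √(μ ⟨x, hx⟩) :=
  dif_pos hx

theorem sqrtDensity_of_notMem (μ : S → ℝ) {x : Λ} (hx : x ∉ S) : sqrtDensity S μ x = 0 :=
  dif_neg hx

theorem rate_eq (hA : IsConservativeQMatrix A) (hs : A.IsSymm) (μ : S → ℝ) :
    rate A S μ = -∑ x ∈ S, ∑ y ∈ S, sqrtDensity S μ x * A x y * sqrtDensity S μ y :=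
  dirichletForm_eq hA hs S _ fun _ => sqrtDensity_of_notMem μ

theorem measurable_sqrtDensity (S : Finset Λ) (x : Λ) : Measurable fun μ => sqrtDensity S μ x := by
  by_cases hx : x ∈ S
  · simp only [sqrtDensity_of_mem _ hx]
    exact (measurable_pi_apply _).sqrt
  · simp only [sqrtDensity_of_notMem _ hx, measurable_const]

theorem measurable_rate (hA : IsConservativeQMatrix A) (hs : A.IsSymm) (S : Finset Λ) :
    Measurable (rate A S) := by
  rw [funext (rate_eq hA hs)]
  exact (Finset.measurable_sum _ fun x _ => Finset.measurable_sum _ fun y _ =>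
    ((measurable_sqrtDensity S x).mul_const _).mul (measurable_sqrtDensity S y)).neg

theorem exists_isMax_sqrtDensity (hμ : μ ∈ stdSimplex ℝ S) :
    ∃ z ∈ S, (∀ x ∈ S, sqrtDensity S μ x ≤ sqrtDensity S μ z) ∧ 0 < sqrtDensity S μ z
      ∧ sqrtDensity S μ z ≤ 1 := by
  obtain ⟨w, -, hw⟩ : ∃ w ∈ Finset.univ, 0 < μ w :=
    Finset.exists_lt_of_sum_lt (by simp only [Finset.sum_const_zero, hμ.2, one_pos])
  obtain ⟨z, hz, hmax⟩ := S.exists_max_image (sqrtDensity S μ) ⟨w, w.2⟩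
  refine ⟨z, hz, hmax, lt_of_lt_of_le ?_ (hmax w w.2), ?_⟩
  · rw [sqrtDensity_of_mem μ w.2]
    exact Real.sqrt_pos.2 hw
  · rw [sqrtDensity_of_mem μ hz, Real.sqrt_le_one]
    exact (mem_Icc_of_mem_stdSimplex hμ _).2

theorem exists_mem_gridFunctions_rate_le (hA : IsConservativeQMatrix A) (hs : A.IsSymm)
    (hμ : μ ∈ stdSimplex ℝ S) {N : ℕ} (hN : 1 ≤ N) :
    ∃ k ∈ gridFunctions S N, rate A S μ
      ≤ ∑ x ∈ S, potential A S (fun y => k y) x * sqrtDensity S μ x ^ 2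
        + S.card * etaConst A S / (2 * N) := by
  obtain ⟨z, hz, hmax, hpos, hle⟩ := exists_isMax_sqrtDensity hμ
  have hN0 : (0 : ℝ) < N := by exact_mod_cast hN
  let c : ℝ := N / sqrtDensity S μ z
  have hc : N ≤ c := le_div_self hN0.le hpos hle
  have hc0 : 0 < c := hN0.trans_le hc
  have hr : ∀ x ∈ S, 0 ≤ c * sqrtDensity S μ x := fun x hx =>
    mul_nonneg hc0.le (sqrtDensity_of_mem μ hx ▸ Real.sqrt_nonneg _)
  have hrz : c * sqrtDensity S μ z = N := div_mul_cancel₀ _ hpos.ne'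
  have hrN : ∀ x ∈ S, c * sqrtDensity S μ x ≤ N := fun x hx =>
    hrz ▸ mul_le_mul_of_nonneg_left (hmax x hx) hc0.le
  obtain ⟨k, hk, hround⟩ := exists_mem_gridFunctions_le_add_one hr hrN hz hrz hN
  have hkN := fun x hx => Finset.mem_Icc.1 (mem_Icc_of_mem_gridFunctions hN hk (x := x) hx)
  refine ⟨k, hk, ?_⟩
  calc rate A S μ ≤ ∑ x ∈ S, potential A S (fun y => k y) x * sqrtDensity S μ x ^ 2
        + S.card * etaConst A S * N / (2 * c ^ 2) := by
        rw [rate_eq hA hs]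
        exact neg_sum_sum_mul_le_of_mul_le_add_one hs hc0.ne' hr
          (fun x hx => (hround x hx).1) (fun x hx => (hround x hx).2)
          (fun x hx => by exact_mod_cast (hkN x hx).1)
          (fun x hx => by exact_mod_cast (hkN x hx).2)
    _ ≤ ∑ x ∈ S, potential A S (fun y => k y) x * sqrtDensity S μ x ^ 2
        + S.card * etaConst A S * N / (2 * N ^ 2) := by
        have := zero_le_one.trans (one_le_etaConst A S)
        gcongr
    _ = _ := by field_simp

end Rate

section LargeDeviations

variable {Λ Ω : Type*} {A : Matrix Λ Λ ℝ} {X : ℝ≥0 → Ω → Λ} {S : Finset Λ}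

theorem sq_sqrtDensity_normalizedLocalTime (T : ℝ≥0) (ω : Ω) {x : Λ} (hx : x ∈ S) :
    sqrtDensity S (normalizedLocalTime X T S ω) x ^ 2 = localTime X T ω x / T := by
  rw [sqrtDensity_of_mem _ hx]
  exact Real.sq_sqrt (div_nonneg (localTime_nonneg ω x T) T.2)

theorem exists_mem_gridFunctions_mul_rate_le (hA : IsConservativeQMatrix A) (hs : A.IsSymm) {ω : Ω}
    (hω : ∀ t, ∀ᶠ s in 𝓝[>] t, X s ω = X t ω) {T : ℝ≥0} (hT : 0 < T)
    (hR : rangeUpTo X T ω ⊆ S) {N : ℕ} (hN : 1 ≤ N) (hηN : etaConst A S * T ≤ N) :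
    ∃ k ∈ gridFunctions S N, T * rate A S (normalizedLocalTime X T S ω)
      ≤ S.card / 2 + ∑ x ∈ S, potential A S (fun y => k y) x * localTime X T ω x := by
  have hT0 : (0 : ℝ) < T := NNReal.coe_pos.2 hT
  have hN0 : (0 : ℝ) < N := by exact_mod_cast hN
  obtain ⟨k, hk, hrate⟩ := exists_mem_gridFunctions_rate_le hA hs
    (normalizedLocalTime_mem_stdSimplex hω hT hR) hN
  refine ⟨k, hk, ?_⟩
  rw [Finset.sum_congr rfl fun x hx => by rw [sq_sqrtDensity_normalizedLocalTime T ω hx]] at hrate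
  have herr : T * (S.card * etaConst A S / (2 * N)) ≤ S.card / 2 := by
    rw [mul_div_assoc', div_le_div_iff₀ (mul_pos two_pos hN0) two_pos]
    nlinarith [mul_le_mul_of_nonneg_left hηN (Nat.cast_nonneg (α := ℝ) S.card)]
  calc T * rate A S (normalizedLocalTime X T S ω)
      ≤ T * (∑ x ∈ S, potential A S (fun y => k y) x * (localTime X T ω x / T)
          + S.card * etaConst A S / (2 * N)) := by gcongr
    _ = T * (S.card * etaConst A S / (2 * N))
          + ∑ x ∈ S, potential A S (fun y => k y) x * localTime X T ω x := by
        rw [mul_add, add_comm, Finset.mul_sum]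
        congr 1
        exact Finset.sum_congr rfl fun x _ => by rw [mul_left_comm, mul_div_cancel₀ _ hT0.ne']
    _ ≤ _ := by gcongr

variable [MeasurableSpace Ω] {P : Λ → Measure Ω}

theorem IsMarkovChain.setLIntegral_exp_potential_le (hX : IsMarkovChain A X P) {T : ℝ≥0}
    (hT : 0 < T) {a : Λ} (ha : a ∈ S) {N : ℕ} (hN : 1 ≤ N) {k : Λ →₀ ℕ}
    (hk : k ∈ gridFunctions S N) :
    ∫⁻ ω in {ω | rangeUpTo X T ω ⊆ S}, ENNReal.ofReal
        (Real.exp (∑ x ∈ S, potential A S (fun y => k y) x * localTime X T ω x)) ∂P a ≤ N := by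
  have hkN := fun x hx => Finset.mem_Icc.1 (mem_Icc_of_mem_gridFunctions hN hk (x := x) hx)
  have hk1 : ∀ x ∈ S, (1 : ℝ) ≤ k x := fun x hx => by exact_mod_cast (hkN x hx).1
  calc _ ≤ ENNReal.ofReal (k a) := hX.setLIntegral_exp_sum_mul_localTime_le hT a hk1 fun x hx =>
        (sum_mul_add_potential_mul (fun y => (k y : ℝ)) (zero_lt_one.trans_le (hk1 x hx)).ne').le
    _ ≤ N := by
        rw [ENNReal.ofReal_natCast]
        exact_mod_cast (hkN a ha).2

theorem IsMarkovChain.setLIntegral_exp_mul_rate_le_card_mul_pow (hX : IsMarkovChain A X P)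
    (hA : IsConservativeQMatrix A) (hs : A.IsSymm) {T : ℝ≥0} (hT : 0 < T) {a : Λ} (ha : a ∈ S)
    {N : ℕ} (hN : 1 ≤ N) (hηN : etaConst A S * T ≤ N) :
    ∫⁻ ω in {ω | rangeUpTo X T ω ⊆ S},
        ENNReal.ofReal (Real.exp (T * rate A S (normalizedLocalTime X T S ω))) ∂P a
      ≤ ENNReal.ofReal (Real.exp (S.card / 2)) * (S.card * N ^ S.card : ℕ) := by
  let W (k : Λ →₀ ℕ) (ω : Ω) : ℝ≥0∞ := ENNReal.ofReal
    (Real.exp (∑ x ∈ S, potential A S (fun y => k y) x * localTime X T ω x))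
  have hW : ∀ k, Measurable (W k) := fun k => hX.measurable_exp_sum_mul_localTime hT _
  have hsum : Measurable fun ω => ∑ k ∈ gridFunctions S N, W k ω :=
    Finset.measurable_sum _ fun k _ => hW k
  calc _ ≤ ∫⁻ ω in {ω | rangeUpTo X T ω ⊆ S},
          ENNReal.ofReal (Real.exp (S.card / 2)) * ∑ k ∈ gridFunctions S N, W k ω ∂P a := by
        refine setLIntegral_mono (hsum.const_mul _) fun ω hR => ?_
        obtain ⟨k, hk, hle⟩ := exists_mem_gridFunctions_mul_rate_le hA hs (hX.rightContinuous ω)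
          hT hR hN hηN
        calc _ ≤ ENNReal.ofReal (Real.exp (S.card / 2)) * W k ω := by
              rw [← ENNReal.ofReal_mul (Real.exp_pos _).le, ← Real.exp_add]
              gcongr
          _ ≤ _ := by
              gcongr
              exact Finset.single_le_sum (f := fun k => W k ω) (fun _ _ => zero_le) hk
    _ = ENNReal.ofReal (Real.exp (S.card / 2))
          * ∑ k ∈ gridFunctions S N, ∫⁻ ω in {ω | rangeUpTo X T ω ⊆ S}, W k ω ∂P a := by
        rw [lintegral_const_mul _ hsum, lintegral_finsetSum _ fun k _ => hW k]
    _ ≤ ENNReal.ofReal (Real.exp (S.card / 2)) * ((gridFunctions S N).card * N : ℕ) := by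
        gcongr
        rw [Nat.cast_mul, ← nsmul_eq_mul]
        exact Finset.sum_le_card_nsmul _ _ _ fun k hk =>
          hX.setLIntegral_exp_potential_le hT ha hN hk
    _ ≤ _ := mul_le_mul_right (Nat.cast_le.2 (card_gridFunctions_mul_le S N)) _

theorem IsMarkovChain.setLIntegral_exp_mul_rate_le (hX : IsMarkovChain A X P)
    (hA : IsConservativeQMatrix A) (hs : A.IsSymm) {T : ℝ≥0} (hT : 0 < T) {a : Λ} (ha : a ∈ S) :
    ∫⁻ ω in {ω | rangeUpTo X T ω ⊆ S},
        ENNReal.ofReal (Real.exp (T * rate A S (normalizedLocalTime X T S ω))) ∂P a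
      ≤ ENNReal.ofReal (Real.exp (S.card * Real.log (etaConst A S * T + 1)
          + Real.log S.card + S.card / 2)) := by
  have hηT : 0 < etaConst A S * T :=
    mul_pos (zero_lt_one.trans_le (one_le_etaConst A S)) (NNReal.coe_pos.2 hT)
  have hcard : (0 : ℝ) < S.card := by exact_mod_cast Finset.card_pos.2 ⟨a, ha⟩
  refine (hX.setLIntegral_exp_mul_rate_le_card_mul_pow hA hs hT ha (Nat.ceil_pos.2 hηT)
    (Nat.le_ceil _)).trans ?_
  rw [← ENNReal.ofReal_natCast, ← ENNReal.ofReal_mul (Real.exp_pos _).le]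
  refine ENNReal.ofReal_le_ofReal ?_
  push_cast
  calc _ ≤ Real.exp (S.card / 2) * (S.card * (etaConst A S * T + 1) ^ S.card) := by
        gcongr
        exact (Nat.ceil_lt_add_one hηT.le).le
    _ = _ := by
        rw [Real.exp_add, Real.exp_add, Real.exp_log hcard, Real.exp_nat_mul,
          Real.exp_log (by positivity)]
        ring

theorem log_setLIntegral_exp_le {μ : Measure Ω} {E E' : Set Ω} {φ ψ : Ω → ℝ} {c : EReal} {K : ℝ}
    (hψ : Measurable ψ) (hE : ∫⁻ ω in E, ENNReal.ofReal (Real.exp (ψ ω)) ∂μ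
      ≤ ENNReal.ofReal (Real.exp K)) (hE' : E' ⊆ E)
    (hφ : ∀ ω ∈ E', ((φ ω - ψ ω : ℝ) : EReal) ≤ c) :
    ENNReal.log (∫⁻ ω in E', ENNReal.ofReal (Real.exp (φ ω)) ∂μ) ≤ c + K := by
  induction c with
  | top => simp
  | bot =>
    have hempty : E' = ∅ := Set.eq_empty_of_forall_notMem fun ω hω =>
      (EReal.bot_lt_coe _).not_ge (hφ ω hω)
    simp [hempty]
  | coe r =>
    have hmeas : Measurable fun ω => ENNReal.ofReal (Real.exp (ψ ω)) :=
      (Real.measurable_exp.comp hψ).ennreal_ofReal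
    have hint : ∫⁻ ω in E', ENNReal.ofReal (Real.exp (φ ω)) ∂μ
        ≤ ENNReal.ofReal (Real.exp (r + K)) := calc
      _ ≤ ∫⁻ ω in E', ENNReal.ofReal (Real.exp r) * ENNReal.ofReal (Real.exp (ψ ω)) ∂μ := by
        refine setLIntegral_mono (hmeas.const_mul _) fun ω hω => ?_
        have hle : φ ω - ψ ω ≤ r := EReal.coe_le_coe_iff.1 (hφ ω hω)
        rw [← ENNReal.ofReal_mul (Real.exp_pos _).le, ← Real.exp_add]
        exact ENNReal.ofReal_le_ofReal (Real.exp_le_exp.2 (sub_le_iff_le_add.1 hle))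
      _ ≤ ENNReal.ofReal (Real.exp r) * ∫⁻ ω in E, ENNReal.ofReal (Real.exp (ψ ω)) ∂μ := by
        rw [← lintegral_const_mul _ hmeas]
        exact lintegral_mono_set hE'
      _ ≤ ENNReal.ofReal (Real.exp (r + K)) := by
        rw [Real.exp_add, ENNReal.ofReal_mul (Real.exp_pos _).le]
        gcongr
    refine (ENNReal.log_le_log hint).trans_eq ?_
    rw [ENNReal.log_ofReal_of_pos (Real.exp_pos _), Real.log_exp, EReal.coe_add]

theorem card_mul_log_add_one_le (n : ℕ) {η T : ℝ} (hη : 1 ≤ η) (hT : 1 ≤ T) :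
    n * Real.log (η * T + 1) + Real.log n + n / 2
      ≤ n * Real.log (η * √(8 * Real.exp 1) * T) + Real.log n + n / (4 * T) := by
  have hηT : 1 ≤ η * T := one_le_mul_of_one_le_of_one_le hη hT
  have hbase : (η * T + 1) * √(Real.exp 1) ≤ η * √(8 * Real.exp 1) * T := calc
    _ ≤ η * T * 2 * √(Real.exp 1) := by gcongr; linarith
    _ ≤ η * T * √8 * √(Real.exp 1) := by gcongr; exact Real.le_sqrt_of_sq_le (by norm_num)
    _ = η * √(8 * Real.exp 1) * T := by rw [Real.sqrt_mul (by norm_num)]; ring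
  have hlog : Real.log (η * T + 1) + 1 / 2 ≤ Real.log (η * √(8 * Real.exp 1) * T) := calc
    _ = Real.log ((η * T + 1) * √(Real.exp 1)) := by
      rw [Real.log_mul (by positivity) (by positivity), Real.log_sqrt (Real.exp_pos _).le,
        Real.log_exp]
    _ ≤ _ := Real.log_le_log (by positivity) hbase
  have hmul := mul_le_mul_of_nonneg_left hlog (Nat.cast_nonneg (α := ℝ) n)
  have hrest : 0 ≤ (n : ℝ) / (4 * T) := by positivity
  linarith

theorem theorem3p5_general (hA : IsConservativeQMatrix A) (hsymm : A.IsSymm)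
    (hX : IsMarkovChain A X P) {T : ℝ} (hT : 0 < T) {a : Λ} (ha : a ∈ S) :
    (∀ Γ : Set (S → ℝ),
      ENNReal.log (P a {ω | normalizedLocalTime X T S ω ∈ Γ ∧ rangeUpTo X T ω ⊆ S})
        ≤ -((T : EReal) * ⨅ μ ∈ Γ ∩ stdSimplex ℝ S, ((rate A S μ : ℝ) : EReal))
          + ((S.card * Real.log (etaConst A S * T + 1) + Real.log S.card + S.card / 2 : ℝ)
            : EReal)) ∧
    (∀ F : (S → ℝ) → ℝ,
      ENNReal.log (∫⁻ ω in {ω | rangeUpTo X T ω ⊆ S},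
          ENNReal.ofReal (Real.exp (T * F (normalizedLocalTime X T S ω))) ∂P a)
        ≤ (T : EReal) * (⨆ μ ∈ stdSimplex ℝ S, ((F μ - rate A S μ : ℝ) : EReal))
          + ((S.card * Real.log (etaConst A S * T + 1) + Real.log S.card + S.card / 2 : ℝ)
            : EReal)) := by
  lift T to ℝ≥0 using hT.le
  rw [NNReal.coe_pos] at hT
  have hT0 : (0 : EReal) ≤ ((T : ℝ) : EReal) := by exact_mod_cast T.2
  have hexp := hX.setLIntegral_exp_mul_rate_le hA hsymm hT ha
  have hmeas : Measurable fun ω => T * rate A S (normalizedLocalTime X T S ω) :=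
    ((measurable_rate hA hsymm S).comp (hX.measurable_normalizedLocalTime hT S)).const_mul _
  have hmem {ω : Ω} := normalizedLocalTime_mem_stdSimplex (hX.rightContinuous ω) hT (S := S)
  refine ⟨fun Γ => ?_, fun F => ?_⟩
  · have hlog := log_setLIntegral_exp_le (φ := fun _ => 0) hmeas hexp
      (E' := {ω | normalizedLocalTime X T S ω ∈ Γ ∧ rangeUpTo X T ω ⊆ S}) (fun ω hω => hω.2)
      (c := -((T : ℝ) * ⨅ μ ∈ Γ ∩ stdSimplex ℝ S, ((rate A S μ : ℝ) : EReal))) fun ω hω => by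
        rw [zero_sub, EReal.coe_neg, EReal.neg_le_neg_iff, EReal.coe_mul]
        exact mul_le_mul_of_nonneg_left (iInf₂_le _ ⟨hω.1, hmem hω.2⟩) hT0
    simpa using hlog
  · refine log_setLIntegral_exp_le hmeas hexp subset_rfl fun ω hω => ?_
    rw [← mul_sub, EReal.coe_mul]
    exact mul_le_mul_of_nonneg_left (le_iSup₂_of_le _ (hmem hω) le_rfl) hT0

end LargeDeviations

theorem theorem3p5 {Λ Ω : Type*} [Countable Λ] [Nontrivial Λ] [MeasurableSpace Ω]
    (A : Matrix Λ Λ ℝ) (hA : IsConservativeQMatrix A) (hsymm : A.IsSymm)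
    (X : ℝ≥0 → Ω → Λ) (P : Λ → Measure Ω) (hX : IsMarkovChain A X P)
    (S : Finset Λ) (T : ℝ) (hT : 1 ≤ T) (a : Λ) (ha : a ∈ S) :
    (∀ Γ : Set (S → ℝ), Γ ⊆ stdSimplex ℝ S → MeasurableSet Γ →
      ENNReal.log (P a {ω | normalizedLocalTime X T S ω ∈ Γ ∧ rangeUpTo X T ω ⊆ S})
        ≤ -((T : EReal) * ⨅ μ ∈ Γ, ((rate A S μ : ℝ) : EReal))
          + (((S.card : ℝ) * Real.log (etaConst A S * √(8 * Real.exp 1) * T)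
              + Real.log (S.card : ℝ) + (S.card : ℝ) / (4 * T) : ℝ) : EReal)) ∧
    (∀ F : (S → ℝ) → ℝ, Measurable (fun μ : stdSimplex ℝ S => F μ) →
      ENNReal.log (∫⁻ ω in {ω | rangeUpTo X T ω ⊆ S},
          ENNReal.ofReal (Real.exp (T * F (normalizedLocalTime X T S ω))) ∂(P a))
        ≤ (T : EReal) * (⨆ μ ∈ stdSimplex ℝ S, ((F μ - rate A S μ : ℝ) : EReal))
          + (((S.card : ℝ) * Real.log (etaConst A S * √(8 * Real.exp 1) * T)
              + Real.log (S.card : ℝ) + (S.card : ℝ) / (4 * T) : ℝ) : EReal)) := by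
  obtain ⟨hprob, hexpect⟩ := theorem3p5_general hA hsymm hX (one_pos.trans_le hT) ha
  have hconst := EReal.coe_le_coe_iff.2 (card_mul_log_add_one_le S.card (one_le_etaConst A S) hT)
  refine ⟨fun Γ hΓ _ => ?_, fun F _ => (hexpect F).trans (by gcongr)⟩
  refine (hprob Γ).trans ?_
  rw [Set.inter_eq_left.2 hΓ]
  gcongr
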